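/- **Theorem 1.2.** Let $N\in\mathbb N$, $0<\mu<N$ and $p,q\ge 1$ be real, and consider the equation $$-\Delta u(x)=\Big(\int_{\mathbb R^N\setminus\{0\}}\frac{|u(y)|^p}{|x-y|^\mu}\,dy\Big)|u(x)|^q,\qquad x\in\mathbb R^N\setminus\{0\}.\tag{1}$$ For $0<\alpha<N$ put $\gamma(\alpha)=2^{\alpha}\pi^{N/2}\,\Gamma(\alpha/2)\big/\Gamma\big(\tfrac{N-\alpha}{2}\big)$, where $\Gamma$ is Euler's Gamma function. Let $$s=\frac{N-\mu+2}{p+q-1}$$ and suppose that $0<sp<N$, $2-N<s(q-1)<2$ and $s<N-2$. Then $s>0$, $$K:=\frac{s(N-2-s)\,\gamma(N-2+s(q-1))}{\gamma(N-\mu)\,\gamma(N-sp)}>0,$$ and, with $A>0$ determined by $A^{p+q-1}=K$, the function $u(x)=A|x|^{-s}$ on $\mathbb R^N\setminus\{0\}$ is a radially symmetric, positive, singular solution of (1). Here singular means that $u(x)\to+\infty$ as $x\to0$; solution means that for every $x\ne0$ the integral in (1) converges, that $u\in C^2(\mathbb R^N\setminus\{0\})$ satisfies (1) at every $x\neq0$,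 and that $u$ is also a weak solution: $u\in C(\mathbb R^N\setminus\{0\})\cap H^1_{\rm loc}(\mathbb R^N\setminus\{0\})$, the right-hand side of (1) is locally integrable on $\mathbb R^N\setminus\{0\}$, and $$\int_{\mathbb R^N\setminus\{0\}}\nabla u\cdot\nabla\varphi\,dx=\int_{\mathbb R^N\setminus\{0\}}\Big(\int_{\mathbb R^N\setminus\{0\}}\frac{|u(y)|^p}{|x-y|^\mu}\,dy\Big)|u(x)|^q\varphi(x)\,dx\qquad\text{for all }\varphi\in C_c^\infty(\mathbb R^N\setminus\{0\}).$$ -/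

import Mathlib

open MeasureTheory Filter Topology
open scoped ContDiff Laplacian Gradient

/-- The normalising constant of the Riesz potential of order `α` on `ℝ^N`,
`γ(α) = 2^α π^{N/2} Γ(α/2) / Γ((N-α)/2)`. -/
noncomputable def rieszGamma (N : ℕ) (α : ℝ) : ℝ :=
  (2 : ℝ) ^ α * Real.pi ^ ((N : ℝ) / 2) * Real.Gamma (α / 2) / Real.Gamma (((N : ℝ) - α) / 2)

/-- The nonlocal term `∫_{ℝ^N ∖ {0}} |u(y)|^p / |x - y|^μ dy`. -/
noncomputable def nonlocalTerm (N : ℕ) (μ p : ℝ) (u : EuclideanSpace ℝ (Fin N) → ℝ)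
    (x : EuclideanSpace ℝ (Fin N)) : ℝ :=
  ∫ y in ({0}ᶜ : Set (EuclideanSpace ℝ (Fin N))), |u y| ^ p / ‖x - y‖ ^ μ

/-- The integral defining the nonlocal term converges at every point of `ℝ^N ∖ {0}`. -/
def NonlocalTermConverges (N : ℕ) (μ p : ℝ) (u : EuclideanSpace ℝ (Fin N) → ℝ) : Prop :=
  ∀ x : EuclideanSpace ℝ (Fin N), x ≠ 0 →
    IntegrableOn (fun y => |u y| ^ p / ‖x - y‖ ^ μ) ({0}ᶜ : Set (EuclideanSpace ℝ (Fin N)))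

/-- `u` is a classical solution of
`-Δu = (∫_{ℝ^N ∖ {0}} |u(y)|^p / |x - y|^μ dy) |u(x)|^q` in `ℝ^N ∖ {0}`. -/
structure IsClassicalSolution (N : ℕ) (μ p q : ℝ) (u : EuclideanSpace ℝ (Fin N) → ℝ) :
    Prop where
  contDiffOn : ContDiffOn ℝ 2 u {0}ᶜ
  converges : NonlocalTermConverges N μ p u
  equation : ∀ x : EuclideanSpace ℝ (Fin N), x ≠ 0 →
    -(Δ u x) = nonlocalTerm N μ p u x * |u x| ^ q

/-- Test functions on `ℝ^N ∖ {0}`: the elements of `C_c^∞(ℝ^N ∖ {0})`. -/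
structure IsTestFunction (N : ℕ) (φ : EuclideanSpace ℝ (Fin N) → ℝ) : Prop where
  contDiff : ContDiff ℝ ∞ φ
  hasCompactSupport : HasCompactSupport φ
  tsupport_subset : tsupport φ ⊆ {0}ᶜ

/-- `G` is the weak gradient of `u` on `ℝ^N ∖ {0}`. -/
structure IsWeakGradient (N : ℕ) (u : EuclideanSpace ℝ (Fin N) → ℝ)
    (G : EuclideanSpace ℝ (Fin N) → EuclideanSpace ℝ (Fin N)) : Prop where
  locallyIntegrableOn : LocallyIntegrableOn u {0}ᶜ
  locallyIntegrableOn_grad : LocallyIntegrableOn G {0}ᶜ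
  integral_eq : ∀ φ : EuclideanSpace ℝ (Fin N) → ℝ, IsTestFunction N φ →
    ∫ x in ({0}ᶜ : Set (EuclideanSpace ℝ (Fin N))), u x • ∇ φ x =
      -∫ x in ({0}ᶜ : Set (EuclideanSpace ℝ (Fin N))), φ x • G x

/-- `u` is a weak solution, continuous and of class `H^1_loc`, of
`-Δu = (∫_{ℝ^N ∖ {0}} |u(y)|^p / |x - y|^μ dy) |u(x)|^q` in `ℝ^N ∖ {0}`. -/
def IsWeakSolution (N : ℕ) (μ p q : ℝ) (u : EuclideanSpace ℝ (Fin N) → ℝ) : Prop :=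
  ContinuousOn u {0}ᶜ ∧
  NonlocalTermConverges N μ p u ∧
  LocallyIntegrableOn (fun x => nonlocalTerm N μ p u x * |u x| ^ q) {0}ᶜ ∧
  ∃ G : EuclideanSpace ℝ (Fin N) → EuclideanSpace ℝ (Fin N),
    IsWeakGradient N u G ∧
    LocallyIntegrableOn (fun x => ‖G x‖ ^ 2) {0}ᶜ ∧
    ∀ φ : EuclideanSpace ℝ (Fin N) → ℝ, IsTestFunction N φ →
      ∫ x in ({0}ᶜ : Set (EuclideanSpace ℝ (Fin N))), inner ℝ (G x) (∇ φ x) =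
        ∫ x in ({0}ᶜ : Set (EuclideanSpace ℝ (Fin N))),
          nonlocalTerm N μ p u x * |u x| ^ q * φ x

/-- `u` is radially symmetric on `ℝ^N ∖ {0}`. -/
def IsRadial (N : ℕ) (u : EuclideanSpace ℝ (Fin N) → ℝ) : Prop :=
  ∀ x y : EuclideanSpace ℝ (Fin N), x ≠ 0 → y ≠ 0 → ‖x‖ = ‖y‖ → u x = u y

/-! The Riesz kernel of order `α` is the superposition of the heat kernels with weights
proportional to `t ^ (α / 2 - 1)`. The semigroup law of the heat kernels and the Beta integral
therefore give the composition law `R_α * R_β = R_{α + β}`. With `α = N - μ` and `β = N - s p` it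
says that the nonlocal term of a multiple of `|x|^{-s}` is again a power of `|x|`, and comparison
with `-Δ|x|^{-s} = s (N - 2 - s) |x|^{-s - 2}` determines both `s` and the amplitude `A`. Test
functions vanish near the origin, so a classical solution is a weak one by integration by parts. -/

section HeatKernel

variable {V : Type*} [NormedAddCommGroup V] [InnerProductSpace ℝ V]

/-- The Gauss–Weierstrass kernel `(4πt)^{-n/2} exp(-|x|²/(4t))` of the heat semigroup on `V`,
where `n` is the dimension of `V`. -/
noncomputable def heatKernel (t : ℝ) (x : V) : ℝ :=
  (4 * Real.pi * t) ^ (-(Module.finrank ℝ V / 2 : ℝ)) * Real.exp (-‖x‖ ^ 2 / (4 * t))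

lemma heatKernel_nonneg {t : ℝ} (ht : 0 ≤ t) (x : V) : 0 ≤ heatKernel t x := by
  unfold heatKernel
  positivity

lemma heatKernel_mul_heatKernel {t r : ℝ} (ht : 0 < t) (hr : 0 < r) (x y : V) :
    heatKernel t (x - y) * heatKernel r y =
      heatKernel (t + r) x * heatKernel (t * r / (t + r)) (y - (r / (t + r)) • x) := by
  have exponents : -‖x - y‖ ^ 2 / (4 * t) + -‖y‖ ^ 2 / (4 * r) = -‖x‖ ^ 2 / (4 * (t + r)) +
      -‖y - (r / (t + r)) • x‖ ^ 2 / (4 * (t * r / (t + r))) := by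
    rw [norm_sub_sq_real, norm_sub_sq_real, norm_smul, inner_smul_right, real_inner_comm,
      Real.norm_of_nonneg (by positivity)]
    field_simp
    ring
  have prefactors (a : ℝ) : (4 * Real.pi * t) ^ a * (4 * Real.pi * r) ^ a =
      (4 * Real.pi * (t + r)) ^ a * (4 * Real.pi * (t * r / (t + r))) ^ a := by
    rw [← Real.mul_rpow (by positivity) (by positivity),
      ← Real.mul_rpow (by positivity) (by positivity)]
    congr 1
    field_simp
  simp only [heatKernel]
  rw [mul_mul_mul_comm, ← Real.exp_add, prefactors, exponents, Real.exp_add, mul_mul_mul_comm]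

variable [MeasurableSpace V] [BorelSpace V]

@[fun_prop]
lemma measurable_heatKernel : Measurable fun z : ℝ × V => heatKernel z.1 z.2 := by
  unfold heatKernel
  fun_prop

variable [FiniteDimensional ℝ V]

lemma lintegral_heatKernel {t : ℝ} (ht : 0 < t) :
    ∫⁻ x : V, ENNReal.ofReal (heatKernel t x) = 1 := by
  have integral_eq_one : ∫ x : V, heatKernel t x = 1 := by
    simp only [heatKernel, div_eq_inv_mul _ (4 * t), mul_neg, ← neg_mul]
    rw [integral_const_mul, GaussianFourier.integral_rexp_neg_mul_sq_norm (by positivity),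
      Real.rpow_neg (by positivity), div_inv_eq_mul, ← mul_assoc, mul_comm Real.pi 4,
      inv_mul_cancel₀ (by positivity)]
  rw [← ofReal_integral_eq_lintegral_ofReal (.of_integral_ne_zero (by simp [integral_eq_one]))
    (.of_forall (heatKernel_nonneg ht.le)), integral_eq_one, ENNReal.ofReal_one]

lemma lintegral_heatKernel_mul_heatKernel {t r : ℝ} (ht : 0 < t) (hr : 0 < r) (x : V) :
    ∫⁻ y, ENNReal.ofReal (heatKernel t (x - y)) * ENNReal.ofReal (heatKernel r y) =
      ENNReal.ofReal (heatKernel (t + r) x) := by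
  simp_rw [← ENNReal.ofReal_mul (heatKernel_nonneg ht.le _), heatKernel_mul_heatKernel ht hr,
    ENNReal.ofReal_mul (heatKernel_nonneg (add_pos ht hr).le _)]
  rw [lintegral_const_mul' _ _ ENNReal.ofReal_ne_top, lintegral_sub_right_eq_self
    (fun y : V => ENNReal.ofReal (heatKernel (t * r / (t + r)) y)),
    lintegral_heatKernel (by positivity), mul_one]

end HeatKernel

section Beta

lemma lintegral_Ioo_rpow_mul_sub_rpow {a b s : ℝ} (ha : 0 < a) (hb : 0 < b) (hs : 0 < s) :
    ∫⁻ t in Set.Ioo 0 s, ENNReal.ofReal (t ^ (a - 1) * (s - t) ^ (b - 1)) =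
      ENNReal.ofReal (ProbabilityTheory.beta a b * s ^ (a + b - 1)) := by
  have hβ := ProbabilityTheory.beta_pos ha hb
  have image_scaling : (fun v => s * v) '' Set.Ioo 0 1 = Set.Ioo 0 s := by
    rw [Set.image_mul_left_Ioo hs, mul_zero, mul_one]
  have hderiv (v : ℝ) (_ : v ∈ Set.Ioo (0 : ℝ) 1) :
      HasDerivWithinAt (fun v => s * v) s (Set.Ioo 0 1) v := by
    simpa using ((hasDerivAt_id v).const_mul s).hasDerivWithinAt
  rw [← image_scaling, lintegral_image_eq_lintegral_abs_deriv_mul measurableSet_Ioo hderiv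
    (mul_right_injective₀ hs.ne').injOn, ← mul_one (ENNReal.ofReal (_ * _)),
    ← ProbabilityTheory.lintegral_betaPDF_eq_one ha hb, ProbabilityTheory.lintegral_betaPDF,
    ← lintegral_const_mul' _ _ ENNReal.ofReal_ne_top]
  refine setLIntegral_congr_fun measurableSet_Ioo fun v ⟨hv, hv'⟩ => ?_
  rw [← ENNReal.ofReal_mul (abs_nonneg s), ← ENNReal.ofReal_mul (by positivity), abs_of_pos hs,
    show s - s * v = s * (1 - v) by ring, Real.mul_rpow hs.le hv.le,
    Real.mul_rpow hs.le (sub_nonneg.2 hv'.le),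
    show a + b - 1 = 1 + (a - 1) + (b - 1) by ring, Real.rpow_add hs, Real.rpow_add hs,
    Real.rpow_one]
  congr 1
  field_simp

lemma lintegral_Ioi_lintegral_Ioi_eq_lintegral_Ioo {F : ℝ → ℝ → ENNReal}
    (hF : Measurable (Function.uncurry F)) :
    ∫⁻ t in Set.Ioi (0 : ℝ), ∫⁻ r in Set.Ioi (0 : ℝ), F t r =
      ∫⁻ s in Set.Ioi (0 : ℝ), ∫⁻ t in Set.Ioo 0 s, F t (s - t) := by
  have translate (t : ℝ) :
      ∫⁻ r in Set.Ioi (0 : ℝ), F t r = ∫⁻ s in Set.Ioi t, F t (s - t) := by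
    rw [← (measurePreserving_sub_right volume t).setLIntegral_comp_preimage measurableSet_Ioi
      (by fun_prop)]
    simp
  calc
    _ = ∫⁻ t in Set.Ioi (0 : ℝ), ∫⁻ s in Set.Ioi (0 : ℝ),
        {z : ℝ × ℝ | z.1 < z.2}.indicator (fun z => F z.1 (z.2 - z.1)) (t, s) := by
      refine setLIntegral_congr_fun measurableSet_Ioi fun t (ht : 0 < t) => ?_
      rw [translate, ← Set.inter_eq_left.2 (Set.Ioi_subset_Ioi ht.le),
        ← setLIntegral_indicator measurableSet_Ioi]
      rfl
    _ = ∫⁻ s in Set.Ioi (0 : ℝ), ∫⁻ t in Set.Ioi (0 : ℝ),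
        {z : ℝ × ℝ | z.1 < z.2}.indicator (fun z => F z.1 (z.2 - z.1)) (t, s) := by
      refine lintegral_lintegral_swap (Measurable.aemeasurable ?_)
      exact Measurable.indicator (by fun_prop) (measurableSet_lt measurable_fst measurable_snd)
    _ = _ := by
      refine lintegral_congr fun s => ?_
      rw [← Set.Ioi_inter_Iio, Set.inter_comm, ← setLIntegral_indicator measurableSet_Iio]
      rfl

end Beta

section RieszKernel

lemma rieszGamma_pos {N : ℕ} {α : ℝ} (hα : 0 < α) (hαN : α < N) : 0 < rieszGamma N α :=
  div_pos (mul_pos (by positivity) (Real.Gamma_pos_of_pos (half_pos hα)))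
    (Real.Gamma_pos_of_pos (half_pos (sub_pos.2 hαN)))

lemma integral_rpow_mul_exp_neg_div_Ioi {c R : ℝ} (hc : 0 < c) (hR : 0 < R) :
    ∫ t in Set.Ioi (0 : ℝ), t ^ (-c - 1) * Real.exp (-R / t) = R ^ (-c) * Real.Gamma c := by
  rw [Real.rpow_neg hR.le, ← Real.inv_rpow hR.le, ← one_div,
    ← Real.integral_rpow_mul_exp_neg_mul_Ioi hc hR,
    ← integral_comp_rpow_Ioi _ (neg_ne_zero.2 one_ne_zero)]
  refine setIntegral_congr_fun measurableSet_Ioi fun t (ht : 0 < t) => ?_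
  simp only [abs_neg, abs_one, one_mul, smul_eq_mul, Real.rpow_neg_one]
  rw [Real.inv_rpow ht.le, ← Real.rpow_neg ht.le, ← mul_assoc, ← Real.rpow_add ht, neg_div,
    div_eq_mul_inv, inv_inv]
  congr 2
  ring

variable {V : Type*} [NormedAddCommGroup V] [InnerProductSpace ℝ V]

/-- The Riesz kernel `|x|^{α-n} / γ(α)` on `V`, where `n` is the dimension of `V`; it is the kernel
of `(-Δ)^{-α/2}`. -/
noncomputable def rieszKernel (α : ℝ) (x : V) : ℝ :=
  ‖x‖ ^ (α - Module.finrank ℝ V) / rieszGamma (Module.finrank ℝ V) α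

lemma rieszKernel_nonneg {α : ℝ} (hα : 0 < α) (hαV : α < Module.finrank ℝ V) (x : V) :
    0 ≤ rieszKernel α x :=
  div_nonneg (by positivity) (rieszGamma_pos hα hαV).le

lemma integral_rpow_mul_heatKernel {α : ℝ} (hα : 0 < α) (hαV : α < Module.finrank ℝ V)
    {x : V} (hx : x ≠ 0) :
    ∫ t in Set.Ioi (0 : ℝ), t ^ (α / 2 - 1) * heatKernel t x =
      Real.Gamma (α / 2) * rieszKernel α x := by
  set n := (Module.finrank ℝ V : ℝ) with hn
  have integrand (t : ℝ) (ht : 0 < t) : t ^ (α / 2 - 1) * heatKernel t x =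
      (4 * Real.pi) ^ (-(n / 2)) *
        (t ^ (-((n - α) / 2) - 1) * Real.exp (-(‖x‖ ^ 2 / 4) / t)) := by
    rw [heatKernel, Real.mul_rpow (by positivity) ht.le, ← hn,
      show -‖x‖ ^ 2 / (4 * t) = -(‖x‖ ^ 2 / 4) / t by ring,
      show -((n - α) / 2) - 1 = α / 2 - 1 + -(n / 2) by ring, Real.rpow_add ht]
    ring
  rw [setIntegral_congr_fun measurableSet_Ioi integrand, integral_const_mul,
    integral_rpow_mul_exp_neg_div_Ioi (by linarith) (by positivity), rieszKernel, rieszGamma, ← hn]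
  have := Real.Gamma_pos_of_pos (half_pos hα)
  have pow_four (a : ℝ) : (4 : ℝ) ^ a = 2 ^ (2 * a) := by
    rw [Real.rpow_mul two_pos.le]
    norm_num
  have norm_pow : (‖x‖ ^ 2) ^ (-((n - α) / 2)) = ‖x‖ ^ (α - n) := by
    rw [← Real.rpow_natCast_mul (norm_nonneg x)]
    congr 1
    push_cast
    ring
  rw [Real.mul_rpow (by positivity) (by positivity), Real.div_rpow (by positivity) (by positivity),
    pow_four, pow_four, norm_pow, Real.rpow_neg (by positivity : 0 ≤ Real.pi),
    show 2 * -((n - α) / 2) = α + 2 * -(n / 2) by ring, Real.rpow_add two_pos]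
  field_simp

lemma lintegral_rpow_mul_heatKernel {α : ℝ} (hα : 0 < α) (hαV : α < Module.finrank ℝ V)
    {x : V} (hx : x ≠ 0) :
    ∫⁻ t in Set.Ioi (0 : ℝ), ENNReal.ofReal (t ^ (α / 2 - 1) * heatKernel t x) =
      ENNReal.ofReal (Real.Gamma (α / 2) * rieszKernel α x) := by
  have integral_ne_zero : Real.Gamma (α / 2) * rieszKernel α x ≠ 0 :=
    mul_ne_zero (Real.Gamma_pos_of_pos (half_pos hα)).ne'
      (div_ne_zero (Real.rpow_pos_of_pos (norm_pos_iff.2 hx) _).ne' (rieszGamma_pos hα hαV).ne')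
  rw [← integral_rpow_mul_heatKernel hα hαV hx] at integral_ne_zero ⊢
  refine (ofReal_integral_eq_lintegral_ofReal (.of_integral_ne_zero integral_ne_zero) ?_).symm
  filter_upwards [ae_restrict_mem measurableSet_Ioi] with t (ht : 0 < t)
  exact mul_nonneg (by positivity) (heatKernel_nonneg ht.le x)

variable [FiniteDimensional ℝ V] [MeasurableSpace V] [BorelSpace V]

lemma ofReal_mul_lintegral_rieszKernel_mul_rieszKernel {α β : ℝ} (hα : 0 < α) (hβ : 0 < β)
    (hαV : α < Module.finrank ℝ V) (hβV : β < Module.finrank ℝ V) {x : V} (hx : x ≠ 0) :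
    ENNReal.ofReal (Real.Gamma (α / 2) * Real.Gamma (β / 2)) *
        ∫⁻ y, ENNReal.ofReal (rieszKernel α (x - y) * rieszKernel β y) =
      ∫⁻ t in Set.Ioi (0 : ℝ), ∫⁻ r in Set.Ioi (0 : ℝ),
        ENNReal.ofReal (t ^ (α / 2 - 1) * r ^ (β / 2 - 1)) *
          ENNReal.ofReal (heatKernel (t + r) x) := by
  have : Nontrivial V := ⟨x, 0, hx⟩
  have hΓα := Real.Gamma_pos_of_pos (half_pos hα)
  have hΓβ := Real.Gamma_pos_of_pos (half_pos hβ)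
  rw [← lintegral_const_mul' _ _ ENNReal.ofReal_ne_top]
  calc
    _ = ∫⁻ y : V, ∫⁻ t in Set.Ioi (0 : ℝ), ∫⁻ r in Set.Ioi (0 : ℝ),
        ENNReal.ofReal (t ^ (α / 2 - 1) * heatKernel t (x - y)) *
          ENNReal.ofReal (r ^ (β / 2 - 1) * heatKernel r y) := by
      refine lintegral_congr_ae ?_
      filter_upwards [Measure.ae_ne volume 0, Measure.ae_ne volume x] with y hy0 hyx
      simp_rw [lintegral_const_mul' _ _ ENNReal.ofReal_ne_top]
      rw [lintegral_rpow_mul_heatKernel hβ hβV hy0, lintegral_mul_const' _ _ ENNReal.ofReal_ne_top,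
        lintegral_rpow_mul_heatKernel hα hαV (sub_ne_zero.2 hyx.symm),
        ← ENNReal.ofReal_mul' (mul_nonneg hΓβ.le (rieszKernel_nonneg hβ hβV y)),
        ← ENNReal.ofReal_mul (mul_nonneg hΓα.le hΓβ.le), mul_mul_mul_comm]
    _ = ∫⁻ t in Set.Ioi (0 : ℝ), ∫⁻ y : V, ∫⁻ r in Set.Ioi (0 : ℝ),
        ENNReal.ofReal (t ^ (α / 2 - 1) * heatKernel t (x - y)) *
          ENNReal.ofReal (r ^ (β / 2 - 1) * heatKernel r y) := by
      refine lintegral_lintegral_swap (Measurable.aemeasurable ?_)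
      exact Measurable.lintegral_prod_right (by fun_prop)
    _ = ∫⁻ t in Set.Ioi (0 : ℝ), ∫⁻ r in Set.Ioi (0 : ℝ), ∫⁻ y : V,
        ENNReal.ofReal (t ^ (α / 2 - 1) * heatKernel t (x - y)) *
          ENNReal.ofReal (r ^ (β / 2 - 1) * heatKernel r y) :=
      lintegral_congr fun t => lintegral_lintegral_swap (by fun_prop)
    _ = _ := by
      refine setLIntegral_congr_fun measurableSet_Ioi fun t (ht : 0 < t) => ?_
      refine setLIntegral_congr_fun measurableSet_Ioi fun r (hr : 0 < r) => ?_
      rw [← lintegral_heatKernel_mul_heatKernel ht hr,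
        ← lintegral_const_mul' _ _ ENNReal.ofReal_ne_top]
      refine lintegral_congr fun y => ?_
      rw [ENNReal.ofReal_mul (by positivity), ENNReal.ofReal_mul (by positivity),
        ENNReal.ofReal_mul (by positivity), mul_mul_mul_comm]

lemma lintegral_rieszKernel_mul_rieszKernel {α β : ℝ} (hα : 0 < α) (hβ : 0 < β)
    (hαβ : α + β < Module.finrank ℝ V) {x : V} (hx : x ≠ 0) :
    ∫⁻ y, ENNReal.ofReal (rieszKernel α (x - y) * rieszKernel β y) =
      ENNReal.ofReal (rieszKernel (α + β) x) := by
  have hα' := half_pos hα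
  have hβ' := half_pos hβ
  have hΓ : 0 < Real.Gamma (α / 2) * Real.Gamma (β / 2) :=
    mul_pos (Real.Gamma_pos_of_pos hα') (Real.Gamma_pos_of_pos hβ')
  have hΓ' := (Real.Gamma_pos_of_pos (add_pos hα' hβ')).ne'
  rw [← ENNReal.mul_right_inj (ENNReal.ofReal_pos.2 hΓ).ne' ENNReal.ofReal_ne_top]
  calc
    _ = ∫⁻ s in Set.Ioi (0 : ℝ), ∫⁻ t in Set.Ioo 0 s,
        ENNReal.ofReal (t ^ (α / 2 - 1) * (s - t) ^ (β / 2 - 1)) *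
          ENNReal.ofReal (heatKernel s x) := by
      rw [ofReal_mul_lintegral_rieszKernel_mul_rieszKernel hα hβ (by linarith) (by linarith) hx,
        lintegral_Ioi_lintegral_Ioi_eq_lintegral_Ioo (by fun_prop)]
      simp only [add_sub_cancel]
    _ = ∫⁻ s in Set.Ioi (0 : ℝ), ENNReal.ofReal (ProbabilityTheory.beta (α / 2) (β / 2)) *
        ENNReal.ofReal (s ^ ((α + β) / 2 - 1) * heatKernel s x) := by
      refine setLIntegral_congr_fun measurableSet_Ioi fun s (hs : 0 < s) => ?_
      rw [lintegral_mul_const' _ _ ENNReal.ofReal_ne_top,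
        lintegral_Ioo_rpow_mul_sub_rpow hα' hβ' hs, ← add_div,
        ENNReal.ofReal_mul (ProbabilityTheory.beta_pos hα' hβ').le,
        ENNReal.ofReal_mul (by positivity), mul_assoc]
    _ = _ := by
      rw [lintegral_const_mul' _ _ ENNReal.ofReal_ne_top,
        lintegral_rpow_mul_heatKernel (add_pos hα hβ) hαβ hx,
        ← ENNReal.ofReal_mul (ProbabilityTheory.beta_pos hα' hβ').le,
        ← ENNReal.ofReal_mul hΓ.le, ProbabilityTheory.beta, ← add_div, ← mul_assoc,
        div_mul_cancel₀ _ (by rwa [add_div])]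

lemma integrable_rieszKernel_mul_rieszKernel {α β : ℝ} (hα : 0 < α) (hβ : 0 < β)
    (hαβ : α + β < Module.finrank ℝ V) {x : V} (hx : x ≠ 0) :
    Integrable fun y => rieszKernel α (x - y) * rieszKernel β y := by
  refine ⟨Measurable.aestronglyMeasurable (by unfold rieszKernel; fun_prop), ?_⟩
  rw [hasFiniteIntegral_iff_ofReal (.of_forall fun y => mul_nonneg
    (rieszKernel_nonneg hα (by linarith) _) (rieszKernel_nonneg hβ (by linarith) _)),
    lintegral_rieszKernel_mul_rieszKernel hα hβ hαβ hx]
  exact ENNReal.ofReal_lt_top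

lemma integral_rieszKernel_mul_rieszKernel {α β : ℝ} (hα : 0 < α) (hβ : 0 < β)
    (hαβ : α + β < Module.finrank ℝ V) {x : V} (hx : x ≠ 0) :
    ∫ y, rieszKernel α (x - y) * rieszKernel β y = rieszKernel (α + β) x := by
  rw [integral_eq_lintegral_of_nonneg_ae (.of_forall fun y => mul_nonneg
    (rieszKernel_nonneg hα (by linarith) _) (rieszKernel_nonneg hβ (by linarith) _))
    (integrable_rieszKernel_mul_rieszKernel hα hβ hαβ hx).aestronglyMeasurable,
    lintegral_rieszKernel_mul_rieszKernel hα hβ hαβ hx,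
    ENNReal.toReal_ofReal (rieszKernel_nonneg (add_pos hα hβ) hαβ x)]

end RieszKernel

section IntegrationByParts

lemma integrable_of_continuousOn_of_tsupport_subset {X E : Type*} [TopologicalSpace X]
    [MeasurableSpace X] [OpensMeasurableSpace X] [NormedAddCommGroup E] {ν : Measure X}
    [IsFiniteMeasureOnCompacts ν] {Ω : Set X} {f : X → E} (hΩ : IsOpen Ω)
    (hf : ContinuousOn f Ω) (hfc : HasCompactSupport f) (hfΩ : tsupport f ⊆ Ω) :
    Integrable f ν :=
  (continuous_of_tsupport fun _ hx => hf.continuousAt (hΩ.mem_nhds (hfΩ hx)))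
    |>.integrable_of_hasCompactSupport hfc

lemma contDiffOn_fderiv_apply {V F : Type*} [NormedAddCommGroup V] [NormedSpace ℝ V]
    [NormedAddCommGroup F] [NormedSpace ℝ F] {Ω : Set V} {u : V → F} {n m : WithTop ℕ∞}
    (hΩ : IsOpen Ω) (hu : ContDiffOn ℝ n u Ω) (hmn : m + 1 ≤ n) (e : V) :
    ContDiffOn ℝ m (fun x => fderiv ℝ u x e) Ω :=
  (hu.fderiv_of_isOpen hΩ hmn).clm_apply contDiffOn_const

variable {V : Type*} [NormedAddCommGroup V] [InnerProductSpace ℝ V] {Ω : Set V} {u φ : V → ℝ}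

lemma continuousOn_gradient [CompleteSpace V] (hΩ : IsOpen Ω) (hu : ContDiffOn ℝ 1 u Ω) :
    ContinuousOn (∇ u) Ω :=
  (InnerProductSpace.toDual ℝ V).symm.continuous.comp_continuousOn
    (hu.continuousOn_fderiv_of_isOpen hΩ le_rfl)

lemma tsupport_gradient_subset [CompleteSpace V] : tsupport (∇ φ) ⊆ tsupport φ :=
  (tsupport_comp_subset (map_zero _) _).trans (tsupport_fderiv_subset ℝ)

lemma gradient_eq_zero_of_notMem_tsupport [CompleteSpace V] {x : V} (hx : x ∉ tsupport φ) :
    ∇ φ x = 0 :=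
  image_eq_zero_of_notMem_tsupport fun h => hx (tsupport_gradient_subset h)

variable [FiniteDimensional ℝ V]

lemma laplacian_eq_sum_fderiv_fderiv {ι : Type*} [Fintype ι] (b : OrthonormalBasis ι ℝ V)
    (hΩ : IsOpen Ω) (hu : ContDiffOn ℝ 2 u Ω) {x : V} (hx : x ∈ Ω) :
    Δ u x = ∑ i, fderiv ℝ (fun y => fderiv ℝ u y (b i)) x (b i) := by
  have hd : DifferentiableAt ℝ (fderiv ℝ u) x :=
    ((hu.fderiv_of_isOpen hΩ le_rfl).contDiffAt (hΩ.mem_nhds hx)).differentiableAt one_ne_zero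
  rw [InnerProductSpace.laplacian_eq_iteratedFDeriv_orthonormalBasis u b]
  refine Finset.sum_congr rfl fun i _ => ?_
  rw [iteratedFDeriv_two_apply, fderiv_clm_apply hd (differentiableAt_const _)]
  simp

lemma continuousOn_laplacian (hΩ : IsOpen Ω) (hu : ContDiffOn ℝ 2 u Ω) :
    ContinuousOn (Δ u) Ω := by
  refine ContinuousOn.congr (continuousOn_finsetSum _ fun i _ => ?_) fun x hx =>
    laplacian_eq_sum_fderiv_fderiv (stdOrthonormalBasis ℝ V) hΩ hu hx
  exact (contDiffOn_fderiv_apply hΩ (contDiffOn_fderiv_apply hΩ hu le_rfl _)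
    (zero_add (1 : WithTop ℕ∞)).le _).continuousOn

variable [MeasurableSpace V] [BorelSpace V]

lemma integrable_mul_fderiv_of_tsupport_subset (hΩ : IsOpen Ω) (hu : ContinuousOn u Ω)
    (hφ : ContDiff ℝ 1 φ) (hφc : HasCompactSupport φ) (hφΩ : tsupport φ ⊆ Ω) (e : V) :
    Integrable fun x => u x * fderiv ℝ φ x e :=
  integrable_of_continuousOn_of_tsupport_subset hΩ
    (hu.mul ((hφ.continuous_fderiv one_ne_zero).clm_apply continuous_const).continuousOn)
    (hφc.fderiv_apply ℝ e).mul_left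
    ((tsupport_mul_subset_right.trans (tsupport_fderiv_apply_subset ℝ e)).trans hφΩ)

lemma integrable_fderiv_mul_of_tsupport_subset (hΩ : IsOpen Ω) (hu : ContDiffOn ℝ 1 u Ω)
    (hφ : ContinuousOn φ Ω) (hφc : HasCompactSupport φ) (hφΩ : tsupport φ ⊆ Ω) (e : V) :
    Integrable fun x => fderiv ℝ u x e * φ x :=
  integrable_of_continuousOn_of_tsupport_subset hΩ
    ((contDiffOn_fderiv_apply hΩ hu (zero_add (1 : WithTop ℕ∞)).le e).continuousOn.mul hφ)
    hφc.mul_left (tsupport_mul_subset_right.trans hφΩ)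

lemma integral_mul_fderiv_eq_neg_of_tsupport_subset (hΩ : IsOpen Ω) (hu : ContDiffOn ℝ 1 u Ω)
    (hφ : ContDiff ℝ 1 φ) (hφc : HasCompactSupport φ) (hφΩ : tsupport φ ⊆ Ω) (e : V) :
    ∫ x, u x * fderiv ℝ φ x e = -∫ x, fderiv ℝ u x e * φ x :=
  integral_mul_fderiv_eq_neg_fderiv_mul_of_integrable
    (integrable_fderiv_mul_of_tsupport_subset hΩ hu hφ.continuous.continuousOn hφc hφΩ e)
    (integrable_mul_fderiv_of_tsupport_subset hΩ hu.continuousOn hφ hφc hφΩ e)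
    (integrable_of_continuousOn_of_tsupport_subset hΩ
      (hu.continuousOn.mul hφ.continuous.continuousOn) hφc.mul_left
      (tsupport_mul_subset_right.trans hφΩ))
    (fun _ hx => (hu.contDiffAt (hΩ.mem_nhds (hφΩ hx))).differentiableAt one_ne_zero)
    fun _ _ => hφ.differentiable one_ne_zero _

lemma integral_smul_gradient_eq_neg_of_tsupport_subset (hΩ : IsOpen Ω) (hu : ContDiffOn ℝ 1 u Ω)
    (hφ : ContDiff ℝ 1 φ) (hφc : HasCompactSupport φ) (hφΩ : tsupport φ ⊆ Ω) :
    ∫ x, u x • ∇ φ x = -∫ x, φ x • ∇ u x := by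
  have integrable_smul_gradient : Integrable fun x => u x • ∇ φ x :=
    integrable_of_continuousOn_of_tsupport_subset hΩ
      (hu.continuousOn.smul (continuousOn_gradient hΩ hφ.contDiffOn))
      (hφc.mono' (subset_closure.trans tsupport_gradient_subset)).smul_left
      (((tsupport_smul_subset_right _ _).trans tsupport_gradient_subset).trans hφΩ)
  have integrable_gradient_smul : Integrable fun x => φ x • ∇ u x :=
    integrable_of_continuousOn_of_tsupport_subset hΩ
      (hφ.continuous.continuousOn.smul (continuousOn_gradient hΩ hu))
      hφc.smul_right ((tsupport_smul_subset_left _ _).trans hφΩ)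
  refine ext_inner_left ℝ fun e => ?_
  rw [inner_neg_right, ← integral_inner integrable_smul_gradient,
    ← integral_inner integrable_gradient_smul]
  simp only [inner_smul_right, inner_gradient_right, conj_trivial, mul_comm (φ _)]
  exact integral_mul_fderiv_eq_neg_of_tsupport_subset hΩ hu hφ hφc hφΩ e

lemma integral_inner_gradient_eq_of_tsupport_subset (hΩ : IsOpen Ω) (hu : ContDiffOn ℝ 2 u Ω)
    (hφ : ContDiff ℝ 1 φ) (hφc : HasCompactSupport φ) (hφΩ : tsupport φ ⊆ Ω) :
    ∫ x, inner ℝ (∇ u x) (∇ φ x) = ∫ x, -(Δ u x) * φ x := by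
  set b := stdOrthonormalBasis ℝ V
  have hDu (i) : ContDiffOn ℝ 1 (fun x => fderiv ℝ u x (b i)) Ω :=
    contDiffOn_fderiv_apply hΩ hu le_rfl (b i)
  calc
    _ = ∫ x, ∑ i, fderiv ℝ u x (b i) * fderiv ℝ φ x (b i) := by
      refine integral_congr_ae (.of_forall fun x => ?_)
      simp only
      rw [← b.sum_inner_mul_inner (∇ u x) (∇ φ x)]
      simp only [inner_gradient_left, inner_gradient_right, conj_trivial]
    _ = ∑ i, ∫ x, fderiv ℝ u x (b i) * fderiv ℝ φ x (b i) :=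
      integral_finsetSum _ fun i _ =>
        integrable_mul_fderiv_of_tsupport_subset hΩ (hDu i).continuousOn hφ hφc hφΩ (b i)
    _ = -∑ i, ∫ x, fderiv ℝ (fun y => fderiv ℝ u y (b i)) x (b i) * φ x := by
      rw [← Finset.sum_neg_distrib]
      exact Finset.sum_congr rfl fun i _ =>
        integral_mul_fderiv_eq_neg_of_tsupport_subset hΩ (hDu i) hφ hφc hφΩ (b i)
    _ = ∫ x, -(∑ i, fderiv ℝ (fun y => fderiv ℝ u y (b i)) x (b i)) * φ x := by
      rw [← integral_finsetSum _ fun i _ => integrable_fderiv_mul_of_tsupport_subset hΩ (hDu i)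
        hφ.continuous.continuousOn hφc hφΩ (b i), ← integral_neg]
      simp only [neg_mul, Finset.sum_mul]
    _ = ∫ x, -(Δ u x) * φ x := by
      refine integral_congr_ae (.of_forall fun x => ?_)
      by_cases hx : x ∈ tsupport φ
      · simp only [laplacian_eq_sum_fderiv_fderiv b hΩ hu (hφΩ hx)]
      · simp only [image_eq_zero_of_notMem_tsupport hx, mul_zero]

end IntegrationByParts

section WeakSolution

variable {N : ℕ} {u φ : EuclideanSpace ℝ (Fin N) → ℝ}

lemma IsTestFunction.setIntegral_eq_integral {E : Type*} [NormedAddCommGroup E] [NormedSpace ℝ E]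
    {f : EuclideanSpace ℝ (Fin N) → E} (hφ : IsTestFunction N φ)
    (hf : ∀ x ∉ tsupport φ, f x = 0) : ∫ x in {0}ᶜ, f x = ∫ x, f x :=
  setIntegral_eq_integral_of_forall_compl_eq_zero fun x hx =>
    hf x fun hxφ => hx (hφ.tsupport_subset hxφ)

lemma isWeakGradient_gradient (hu : ContDiffOn ℝ 1 u {0}ᶜ) : IsWeakGradient N u (∇ u) where
  locallyIntegrableOn := hu.continuousOn.locallyIntegrableOn (measurableSet_singleton 0).compl
  locallyIntegrableOn_grad := (continuousOn_gradient isOpen_compl_singleton hu).locallyIntegrableOn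
    (measurableSet_singleton 0).compl
  integral_eq φ hφ := by
    rw [hφ.setIntegral_eq_integral fun x hx => ?_, hφ.setIntegral_eq_integral fun x hx => ?_]
    · exact integral_smul_gradient_eq_neg_of_tsupport_subset isOpen_compl_singleton hu
        (hφ.contDiff.of_le (by simp)) hφ.hasCompactSupport hφ.tsupport_subset
    · rw [image_eq_zero_of_notMem_tsupport hx, zero_smul]
    · rw [gradient_eq_zero_of_notMem_tsupport hx, smul_zero]

lemma IsClassicalSolution.isWeakSolution {μ p q : ℝ} (hu : IsClassicalSolution N μ p q u) :
    IsWeakSolution N μ p q u := by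
  have hu1 : ContDiffOn ℝ 1 u {0}ᶜ := hu.contDiffOn.of_le one_le_two
  have hmeas : MeasurableSet ({0}ᶜ : Set (EuclideanSpace ℝ (Fin N))) :=
    (measurableSet_singleton 0).compl
  refine ⟨hu.contDiffOn.continuousOn, hu.converges, ?_, ∇ u, isWeakGradient_gradient hu1,
    ((continuousOn_gradient isOpen_compl_singleton hu1).norm.pow 2).locallyIntegrableOn hmeas,
    fun φ hφ => ?_⟩
  · exact ((continuousOn_laplacian isOpen_compl_singleton hu.contDiffOn).neg.congr
      fun x hx => (hu.equation x hx).symm).locallyIntegrableOn hmeas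
  · calc
      _ = ∫ x, inner ℝ (∇ u x) (∇ φ x) := hφ.setIntegral_eq_integral fun x hx => by
        rw [gradient_eq_zero_of_notMem_tsupport hx, inner_zero_right]
      _ = ∫ x, -(Δ u x) * φ x := integral_inner_gradient_eq_of_tsupport_subset
        isOpen_compl_singleton hu.contDiffOn (hφ.contDiff.of_le (by simp)) hφ.hasCompactSupport
        hφ.tsupport_subset
      _ = ∫ x in {0}ᶜ, -(Δ u x) * φ x := (hφ.setIntegral_eq_integral fun x hx => by
        rw [image_eq_zero_of_notMem_tsupport hx, mul_zero]).symm
      _ = _ := setIntegral_congr_fun hmeas fun x hx => by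
        simp only [hu.equation x hx]

end WeakSolution

section NormPower

variable {V : Type*} [NormedAddCommGroup V] [InnerProductSpace ℝ V]

lemma contDiffOn_norm_rpow (r : ℝ) {n : WithTop ℕ∞} :
    ContDiffOn ℝ n (fun y : V => ‖y‖ ^ r) {0}ᶜ :=
  fun _ hx => ((contDiffAt_norm ℝ hx).rpow_const_of_ne (norm_ne_zero_iff.2 hx)).contDiffWithinAt

lemma hasFDerivAt_norm_rpow_of_ne (r : ℝ) {x : V} (hx : x ≠ 0) :
    HasFDerivAt (fun y : V => ‖y‖ ^ r) ((r * ‖x‖ ^ (r - 2)) • innerSL ℝ x) x := by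
  convert ((hasStrictFDerivAt_norm_sq x).rpow_const (p := r / 2) (by simp [hx])).hasFDerivAt
    using 0
  simp_rw [← Real.rpow_natCast_mul (norm_nonneg _), ← Nat.cast_smul_eq_nsmul ℝ, smul_smul]
  ring_nf

lemma fderiv_norm_rpow_apply {r : ℝ} {x : V} (hx : x ≠ 0) (e : V) :
    fderiv ℝ (fun y : V => ‖y‖ ^ r) x e = r * (‖x‖ ^ (r - 2) * inner ℝ x e) := by
  rw [(hasFDerivAt_norm_rpow_of_ne r hx).fderiv]
  simp [mul_assoc]

lemma fderiv_fderiv_norm_rpow_apply (r : ℝ) {x : V} (hx : x ≠ 0) (e : V) :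
    fderiv ℝ (fun y : V => fderiv ℝ (fun z : V => ‖z‖ ^ r) y e) x e =
      r * ((r - 2) * ‖x‖ ^ (r - 4) * (inner ℝ x e * inner ℝ e x) + ‖x‖ ^ (r - 2) * ‖e‖ ^ 2) := by
  have fderiv_near : (fun y => fderiv ℝ (fun z : V => ‖z‖ ^ r) y e) =ᶠ[𝓝 x]
      fun y => r * (‖y‖ ^ (r - 2) * innerSL ℝ e y) := by
    filter_upwards [isOpen_compl_singleton.mem_nhds hx] with y hy
    rw [fderiv_norm_rpow_apply hy, innerSL_apply_apply, real_inner_comm]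
  rw [fderiv_near.fderiv_eq, (((hasFDerivAt_norm_rpow_of_ne (r - 2) hx).fun_mul
    (innerSL ℝ e).hasFDerivAt).const_mul r).fderiv, show r - 2 - 2 = r - 4 by ring]
  simp only [coe_innerSL_apply, real_inner_comm, smul_add, add_apply, smul_apply,
    inner_self_eq_norm_sq_to_K, Real.ringHom_apply, smul_eq_mul]
  ring

lemma laplacian_norm_rpow [FiniteDimensional ℝ V] (r : ℝ) {x : V} (hx : x ≠ 0) :
    Δ (fun y : V => ‖y‖ ^ r) x = r * (r + Module.finrank ℝ V - 2) * ‖x‖ ^ (r - 2) := by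
  have norm_pow : ‖x‖ ^ (r - 2) = ‖x‖ ^ (r - 4) * ‖x‖ ^ 2 := by
    rw [← Real.rpow_add_natCast (norm_ne_zero_iff.2 hx)]
    congr 1
    push_cast
    ring
  set b := stdOrthonormalBasis ℝ V
  rw [laplacian_eq_sum_fderiv_fderiv b isOpen_compl_singleton (contDiffOn_norm_rpow r) hx]
  simp only [fderiv_fderiv_norm_rpow_apply r hx, b.norm_eq_one]
  rw [← Finset.mul_sum, Finset.sum_add_distrib, ← Finset.mul_sum, b.sum_inner_mul_inner,
    real_inner_self_eq_norm_sq, norm_pow]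
  simp only [one_pow, mul_one, Finset.sum_const, Finset.card_univ, Fintype.card_fin, nsmul_eq_mul]
  ring

lemma laplacian_const_mul_norm_rpow_neg [FiniteDimensional ℝ V] (A s : ℝ) {x : V} (hx : x ≠ 0) :
    Δ (fun y : V => A * ‖y‖ ^ (-s)) x =
      -(A * (s * (Module.finrank ℝ V - 2 - s) * ‖x‖ ^ (-s - 2))) := by
  have contDiffAt := (contDiffOn_norm_rpow (-s) (n := 2)).contDiffAt
    (isOpen_compl_singleton.mem_nhds hx)
  change Δ (A • fun y : V => ‖y‖ ^ (-s)) x = _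
  rw [InnerProductSpace.laplacian_smul A contDiffAt, laplacian_norm_rpow _ hx, smul_eq_mul]
  ring

end NormPower

section PowerSolution

variable {N : ℕ} {A s p q μ : ℝ}

lemma tendsto_const_mul_norm_rpow_neg_atTop {V : Type*} [NormedAddCommGroup V] (hA : 0 < A)
    (hs : 0 < s) : Tendsto (fun y : V => A * ‖y‖ ^ (-s)) (𝓝[≠] 0) atTop :=
  ((tendsto_rpow_neg_nhdsGT_zero (neg_lt_zero.2 hs)).comp tendsto_norm_nhdsNE_zero).const_mul_atTop
    hA

lemma abs_const_mul_norm_rpow_rpow {V : Type*} [NormedAddCommGroup V] (hA : 0 ≤ A)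
    (s r : ℝ) (y : V) : |A * ‖y‖ ^ (-s)| ^ r = A ^ r * ‖y‖ ^ (-(s * r)) := by
  rw [abs_of_nonneg (by positivity), Real.mul_rpow hA (by positivity),
    ← Real.rpow_mul (norm_nonneg y), neg_mul]

lemma nonlocal_integrand_eq (hA : 0 ≤ A) (hμ : 0 < μ) (hμN : μ < N) (hsp : 0 < s * p)
    (hspN : s * p < N) (x y : EuclideanSpace ℝ (Fin N)) :
    |A * ‖y‖ ^ (-s)| ^ p / ‖x - y‖ ^ μ =
      A ^ p * (rieszGamma N (N - μ) * rieszGamma N (N - s * p)) *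
        (rieszKernel (N - μ) (x - y) * rieszKernel (N - s * p) y) := by
  have hγμ := rieszGamma_pos (sub_pos.2 hμN) (sub_lt_self _ hμ)
  have hγp := rieszGamma_pos (sub_pos.2 hspN) (sub_lt_self _ hsp)
  rw [abs_const_mul_norm_rpow_rpow hA, rieszKernel, rieszKernel, finrank_euclideanSpace_fin,
    sub_sub_cancel_left, sub_sub_cancel_left, div_eq_mul_inv, ← Real.rpow_neg (norm_nonneg _)]
  field_simp

lemma nonlocalTermConverges_norm_rpow (hA : 0 ≤ A) (hμ : 0 < μ) (hμN : μ < N) (hsp : 0 < s * p)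
    (hspN : s * p < N) (h : (N : ℝ) < μ + s * p) :
    NonlocalTermConverges N μ p fun y => A * ‖y‖ ^ (-s) := fun x hx => by
  simp only [nonlocal_integrand_eq hA hμ hμN hsp hspN]
  exact ((integrable_rieszKernel_mul_rieszKernel (sub_pos.2 hμN) (sub_pos.2 hspN)
    (by rw [finrank_euclideanSpace_fin]; linarith) hx).const_mul _).integrableOn

lemma nonlocalTerm_norm_rpow (hA : 0 ≤ A) (hμ : 0 < μ) (hμN : μ < N) (hsp : 0 < s * p)
    (hspN : s * p < N) (h : (N : ℝ) < μ + s * p) {x : EuclideanSpace ℝ (Fin N)} (hx : x ≠ 0) :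
    nonlocalTerm N μ p (fun y => A * ‖y‖ ^ (-s)) x =
      A ^ p * (rieszGamma N (N - μ) * rieszGamma N (N - s * p)) *
        (‖x‖ ^ (N - μ - s * p) / rieszGamma N (N - μ + (N - s * p))) := by
  have : Nontrivial (EuclideanSpace ℝ (Fin N)) := ⟨x, 0, hx⟩
  have restrict_eq : (volume : Measure (EuclideanSpace ℝ (Fin N))).restrict {0}ᶜ = volume :=
    Measure.restrict_eq_self_of_ae_mem (Measure.ae_ne volume 0)
  simp only [nonlocalTerm, nonlocal_integrand_eq hA hμ hμN hsp hspN]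
  rw [restrict_eq, integral_const_mul,
    integral_rieszKernel_mul_rieszKernel (sub_pos.2 hμN) (sub_pos.2 hspN)
      (by rw [finrank_euclideanSpace_fin]; linarith) hx,
    rieszKernel, finrank_euclideanSpace_fin,
    show (N : ℝ) - μ + (N - s * p) - N = N - μ - s * p by ring]

lemma isClassicalSolution_norm_rpow (hA : 0 < A) (hμ : 0 < μ) (hμN : μ < N) (hsp : 0 < s * p)
    (hspN : s * p < N) (hsq : s * (q - 1) < 2) (hs : s * (p + q - 1) = N - μ + 2)
    (hAK : A ^ (p + q - 1) = s * (N - 2 - s) * rieszGamma N (N - 2 + s * (q - 1)) /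
      (rieszGamma N (N - μ) * rieszGamma N (N - s * p))) :
    IsClassicalSolution N μ p q fun y => A * ‖y‖ ^ (-s) := by
  have hμsp : (N : ℝ) < μ + s * p := by linarith
  have order_eq : (N : ℝ) - μ + (N - s * p) = N - 2 + s * (q - 1) := by linarith
  have hγμ := rieszGamma_pos (sub_pos.2 hμN) (sub_lt_self _ hμ)
  have hγp := rieszGamma_pos (sub_pos.2 hspN) (sub_lt_self _ hsp)
  have hγ : 0 < rieszGamma N (N - 2 + s * (q - 1)) := rieszGamma_pos (by linarith) (by linarith)
  refine ⟨contDiffOn_const.mul (contDiffOn_norm_rpow (-s)),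
    nonlocalTermConverges_norm_rpow hA.le hμ hμN hsp hspN hμsp, fun x hx => ?_⟩
  have amplitude : A ^ p * A ^ q = A ^ (p + q - 1) * A := by
    rw [← Real.rpow_add hA, ← Real.rpow_add_one hA.ne', sub_add_cancel]
  have decay : ‖x‖ ^ ((N : ℝ) - μ - s * p) * ‖x‖ ^ (-(s * q)) = ‖x‖ ^ (-s - 2) := by
    rw [← Real.rpow_add (norm_pos_iff.2 hx)]
    congr 1
    linarith
  rw [laplacian_const_mul_norm_rpow_neg A s hx, finrank_euclideanSpace_fin,
    nonlocalTerm_norm_rpow hA.le hμ hμN hsp hspN hμsp hx, abs_const_mul_norm_rpow_rpow hA.le,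
    order_eq]
  calc
    _ = A ^ (p + q - 1) * A * (rieszGamma N (N - μ) * rieszGamma N (N - s * p)) /
        rieszGamma N (N - 2 + s * (q - 1)) * ‖x‖ ^ (-s - 2) := by
      rw [hAK]
      field_simp
    _ = _ := by
      rw [← amplitude, ← decay]
      ring

end PowerSolution

theorem theorem1p2_general (N : ℕ) (μ p q s : ℝ)
    (hμ₀ : 0 < μ) (hμN : μ < N) (hpq : 1 < p + q)
    (hs : s = ((N : ℝ) - μ + 2) / (p + q - 1))
    (hsp₀ : 0 < s * p) (hspN : s * p < N)
    (hsq : s * (q - 1) < 2) (hsN : s < (N : ℝ) - 2) :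
    0 < s ∧
    0 < s * ((N : ℝ) - 2 - s) * rieszGamma N ((N : ℝ) - 2 + s * (q - 1)) /
      (rieszGamma N ((N : ℝ) - μ) * rieszGamma N ((N : ℝ) - s * p)) ∧
    ∃ A : ℝ, 0 < A ∧
      A ^ (p + q - 1) =
        s * ((N : ℝ) - 2 - s) * rieszGamma N ((N : ℝ) - 2 + s * (q - 1)) /
          (rieszGamma N ((N : ℝ) - μ) * rieszGamma N ((N : ℝ) - s * p)) ∧
      ∃ u : EuclideanSpace ℝ (Fin N) → ℝ,
        (∀ x, x ≠ 0 → u x = A / ‖x‖ ^ s) ∧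
        IsRadial N u ∧
        (∀ x, x ≠ 0 → 0 < u x) ∧
        Tendsto u (𝓝[≠] 0) atTop ∧
        IsClassicalSolution N μ p q u ∧
        IsWeakSolution N μ p q u := by
  have hpq' : 0 < p + q - 1 := by linarith
  have hs' : s * (p + q - 1) = N - μ + 2 := by rw [hs, div_mul_cancel₀ _ hpq'.ne']
  have hs₀ : 0 < s := hs ▸ div_pos (by linarith) hpq'
  set K := s * ((N : ℝ) - 2 - s) * rieszGamma N ((N : ℝ) - 2 + s * (q - 1)) /
    (rieszGamma N ((N : ℝ) - μ) * rieszGamma N ((N : ℝ) - s * p)) with hK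
  have hK₀ : 0 < K := div_pos
    (mul_pos (mul_pos hs₀ (by linarith)) (rieszGamma_pos (by linarith) (by linarith)))
    (mul_pos (rieszGamma_pos (by linarith) (by linarith))
      (rieszGamma_pos (by linarith) (by linarith)))
  have hA₀ : 0 < K ^ (p + q - 1)⁻¹ := Real.rpow_pos_of_pos hK₀ _
  have hAK : (K ^ (p + q - 1)⁻¹) ^ (p + q - 1) = K := Real.rpow_inv_rpow hK₀.le hpq'.ne'
  have solution := isClassicalSolution_norm_rpow hA₀ hμ₀ hμN hsp₀ hspN hsq hs' (hAK.trans hK)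
  refine ⟨hs₀, hK₀, K ^ (p + q - 1)⁻¹, hA₀, hAK, fun y => K ^ (p + q - 1)⁻¹ * ‖y‖ ^ (-s),
    fun x _ => ?_, fun x y _ _ hxy => ?_, fun x hx => ?_,
    tendsto_const_mul_norm_rpow_neg_atTop hA₀ hs₀, solution, solution.isWeakSolution⟩
  · simp only [Real.rpow_neg (norm_nonneg x), div_eq_mul_inv]
  · simp only [hxy]
  · have := norm_pos_iff.2 hx
    positivity

theorem theorem1p2 (N : ℕ) (μ p q s : ℝ)
    (hμ₀ : 0 < μ) (hμN : μ < N) (hp : 1 ≤ p) (hq : 1 ≤ q)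
    (hs : s = ((N : ℝ) - μ + 2) / (p + q - 1))
    (hsp₀ : 0 < s * p) (hspN : s * p < N)
    (hsq₀ : 2 - (N : ℝ) < s * (q - 1)) (hsq : s * (q - 1) < 2)
    (hsN : s < (N : ℝ) - 2) :
    0 < s ∧
    0 < s * ((N : ℝ) - 2 - s) * rieszGamma N ((N : ℝ) - 2 + s * (q - 1)) /
      (rieszGamma N ((N : ℝ) - μ) * rieszGamma N ((N : ℝ) - s * p)) ∧
    ∃ A : ℝ, 0 < A ∧
      A ^ (p + q - 1) =
        s * ((N : ℝ) - 2 - s) * rieszGamma N ((N : ℝ) - 2 + s * (q - 1)) /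
          (rieszGamma N ((N : ℝ) - μ) * rieszGamma N ((N : ℝ) - s * p)) ∧
      ∃ u : EuclideanSpace ℝ (Fin N) → ℝ,
        (∀ x, x ≠ 0 → u x = A / ‖x‖ ^ s) ∧
        IsRadial N u ∧
        (∀ x, x ≠ 0 → 0 < u x) ∧
        Tendsto u (𝓝[≠] 0) atTop ∧
        IsClassicalSolution N μ p q u ∧
        IsWeakSolution N μ p q u :=
  theorem1p2_general N μ p q s hμ₀ hμN (by linarith) hs hsp₀ hspN hsq hsN
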